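/- Let $n\ge 2$. **Definitions.** Let $O\subseteq\mathbb R^n$ be open. A set $\Gamma\subseteq\partial O$ is a *smooth boundary piece* of $O$ if there are an open set $W\subseteq\mathbb R^n$, Cartesian coordinates $x=(x',x_n)$ on $\mathbb R^n$ (obtained from the standard ones by an orthogonal transformation), and a function $\gamma\in C^\infty(\mathbb R^{n-1},\mathbb R)$ such that $$\Gamma=\partial O\cap W=\{x\in W : x_n=\gamma(x')\},\qquad O\cap W=\{x\in W : x_n>\gamma(x')\}.$$ $O$ has *smooth boundary* if $\partial O$ is a union of smooth boundary pieces of $O$, and *piecewise smooth boundary* if $\partial O$ is a countable union of closures of smooth boundary pieces of $O$. A *domain* is a non-empty, connected, open set; a *smoothly bounded domain* is a bounded domain with smooth boundary. Let $\Omega\subset\mathbb R^n$ be a smoothly bounded domain. A real-valued function $\sigma\in L^\infty(\Omega)$ is *piecewise analytic* if there are finitely many pairwise disjoint domains $O_1,\dots,O_M\subseteq\Omega$ with piecewise smooth boundaries such that $\overline\Omega=\overline{O_1\cup\dots\cup O_M}$ and, for each $m$, $\sigma|_{O_m}$ has an extension that is real-analytic in a neighbourhood of $\overline{O_m}$. A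 relatively open set $U\subseteq\overline\Omega$ is *connected to $\partial\Omega$* if $U\cap\Omega$ is connected and $U\cap\partial\Omega\ne\emptyset$. Equalities and inequalities for $\sigma$ on a subset of $\overline\Omega$ are understood almost everywhere on its intersection with $\Omega$. **Theorem.** Let $\Omega\subset\mathbb R^n$, $n\ge2$, be a smoothly bounded domain and let $\sigma\in L^\infty(\Omega)$ be piecewise analytic. Let $U\subseteq\overline\Omega$ be relatively open and connected to $\partial\Omega$, and let $\sigma|_U\not\equiv0$. Then there is a subset $V\subseteq U$ such that (a) $V\subseteq\overline\Omega$ is relatively open and connected to $\partial\Omega$; (b) $\sigma|_V\not\equiv0$, and either $\sigma|_V\ge0$ or $\sigma|_V\le0$. -/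

import Mathlib

open MeasureTheory Set
open scoped ContDiff

namespace PiecewiseAnalytic

/-- Euclidean space `ℝⁿ`. -/
abbrev E (n : ℕ) : Type := EuclideanSpace ℝ (Fin n)

/-- A linear isometry of `ℝⁿ` onto `ℝⁿ⁻¹ × ℝ` (with the Euclidean norm): a choice of Cartesian
coordinates `(x', xₙ)` on `ℝⁿ` ("relabeling and reorienting" the standard ones). -/
abbrev Coordinates (n : ℕ) : Type := E n ≃ₗᵢ[ℝ] WithLp 2 (E (n - 1) × ℝ)

/-- `Γ` is a smooth boundary piece of the set `O`: there are an open set `W`, Cartesian coordinates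
`(x', xₙ)` and `γ ∈ C^∞(ℝⁿ⁻¹)` such that `Γ = ∂O ∩ W = {x ∈ W | xₙ = γ(x')}` and
`O ∩ W = {x ∈ W | xₙ > γ(x')}`. -/
def IsSmoothBoundaryPiece {n : ℕ} (O Γ : Set (E n)) : Prop :=
  ∃ (W : Set (E n)) (e : Coordinates n) (γ : E (n - 1) → ℝ),
    IsOpen W ∧ ContDiff ℝ ∞ γ ∧
    Γ = frontier O ∩ W ∧
    frontier O ∩ W = {x ∈ W | (e x).snd = γ (e x).fst} ∧
    O ∩ W = {x ∈ W | γ (e x).fst < (e x).snd}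

/-- The boundary of `O` is a union of smooth boundary pieces. -/
def HasSmoothBoundary {n : ℕ} (O : Set (E n)) : Prop :=
  ∃ S : Set (Set (E n)), (∀ Γ ∈ S, IsSmoothBoundaryPiece O Γ) ∧ frontier O = ⋃₀ S

/-- The boundary of `O` is a countable union of closures of smooth boundary pieces. -/
def HasPiecewiseSmoothBoundary {n : ℕ} (O : Set (E n)) : Prop :=
  ∃ S : Set (Set (E n)), S.Countable ∧ (∀ Γ ∈ S, IsSmoothBoundaryPiece O Γ) ∧
    frontier O = ⋃ Γ ∈ S, closure Γ

/-- A smoothly bounded domain: bounded, open, connected (and non-empty), with smooth boundary. -/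
structure IsSmoothlyBoundedDomain {n : ℕ} (Ω : Set (E n)) : Prop where
  isOpen : IsOpen Ω
  isConnected : IsConnected Ω
  isBounded : Bornology.IsBounded Ω
  hasSmoothBoundary : HasSmoothBoundary Ω

/-- `σ ∈ L^∞(Ω)` is piecewise analytic. As `σ` is only determined almost everywhere, `σ|_{O_m}` has
the extension `f` if `σ = f` almost everywhere on `O_m`. -/
def IsPiecewiseAnalytic {n : ℕ} (Ω : Set (E n)) (σ : E n → ℝ) : Prop :=
  MemLp σ ⊤ (volume.restrict Ω) ∧
  ∃ (M : ℕ) (O : Fin M → Set (E n)),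
    (∀ m, IsOpen (O m) ∧ IsConnected (O m) ∧ O m ⊆ Ω ∧ HasPiecewiseSmoothBoundary (O m)) ∧
    Pairwise (fun m m' => Disjoint (O m) (O m')) ∧
    closure Ω = closure (⋃ m, O m) ∧
    ∀ m, ∃ f : E n → ℝ, AnalyticOnNhd ℝ f (closure (O m)) ∧ ∀ᵐ x ∂volume.restrict (O m), σ x = f x

/-- `U` is a relatively open subset of the closure of `Ω`. -/
def IsRelOpen {n : ℕ} (Ω U : Set (E n)) : Prop :=
  ∃ G : Set (E n), IsOpen G ∧ U = G ∩ closure Ω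

/-- `U` is connected to the boundary of `Ω`. -/
def IsConnectedToBoundary {n : ℕ} (Ω U : Set (E n)) : Prop :=
  IsConnected (U ∩ Ω) ∧ (U ∩ frontier Ω).Nonempty

end PiecewiseAnalytic

/-!
Let `N` be the union of those pieces `O m` on which `σ` does not vanish identically. Away from
`closure N`, `σ` vanishes almost everywhere, the boundaries of the pieces being null sets. The set
`V` is obtained from an open set `A` that is either the exterior of `Ω` (if `closure N` contains
all boundary points of `Ω` in `U`) or a component of the region of zeros in `U ∩ Ω` that reaches
the boundary of `Ω` (otherwise). In both cases the boundary of `A` in the relevant open set is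
non-empty and covered by the boundaries of the pieces that make up `N`, and it suffices to find a
small neighbourhood `B` of a boundary point of `A` on which `σ` is definite: `V` is then `B ∩
closure Ω` in the first case, and in the second the part in `closure Ω` of the union of `B`, `A`
and a neighbourhood of a boundary point of `Ω` that `A` reaches.

Finding `B`, for an arbitrary open set `A` disjoint from `N`, is the content of
`exists_contact_nhds`. By Baire's theorem, near some point the boundary of `A` lies in the closure
of a single smooth boundary piece of a single `O i`, hence in the graph of a function. Each side
of the graph is then contained in `A` or disjoint from `A`, and since both `A` and its complement
have interior points nearby, the whole graph is boundary of `A` there and `A` lies on one side of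
it (`one_sided_of_frontier_subset`). Passing to a point of the smooth boundary piece itself, one
side of the graph belongs to `A` and the other to `O i`.

The sign on the side of `O i` comes from analyticity (`exists_box_sign`). Not all derivatives of
`f i` in the direction transversal to the graph vanish identically on the graph, as `f i` would
otherwise vanish on all transversal segments. At a point of the graph where the derivative of
minimal such order `k` is nonzero, that derivative keeps its sign nearby while the lower ones
vanish on the graph; integrating `k` times from the graph shows that `f i` has the same strict
sign.
-/

namespace PiecewiseAnalytic

open Filter Topology Metric

/-! ### Iterated directional derivatives -/

section Directional

variable {X : Type*} [NormedAddCommGroup X] [NormedSpace ℝ X]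

/-- The `k`-th derivative of `f` in the fixed direction `v`, as a function of the base point. -/
noncomputable def iterDirDeriv (v : X) (f : X → ℝ) : ℕ → X → ℝ
  | 0 => f
  | k + 1 => fun x => fderiv ℝ (iterDirDeriv v f k) x v

theorem analyticOnNhd_iterDirDeriv {v : X} {f : X → ℝ} {s : Set X} (hf : AnalyticOnNhd ℝ f s)
    (k : ℕ) : AnalyticOnNhd ℝ (iterDirDeriv v f k) s := by
  induction k with
  | zero => exact hf
  | succ k ih =>
    intro x hx
    exact ((ContinuousLinearMap.apply ℝ ℝ v).analyticAt _).comp (ih.fderiv x hx)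

theorem hasDerivAt_iterDirDeriv {v : X} {f : X → ℝ} {s : Set X} (hf : AnalyticOnNhd ℝ f s)
    (k : ℕ) {x : X} {t : ℝ} (hx : x + t • v ∈ s) :
    HasDerivAt (fun u : ℝ => iterDirDeriv v f k (x + u • v))
      (iterDirDeriv v f (k + 1) (x + t • v)) t := by
  have h1 : HasDerivAt (fun u : ℝ => x + u • v) v t := by
    simpa using ((hasDerivAt_id t).smul_const v).const_add x
  exact (analyticOnNhd_iterDirDeriv hf k _ hx).differentiableAt.hasFDerivAt.comp_hasDerivAt t h1

theorem eqOn_zero_of_iteratedDeriv_eq_zero {φ : ℝ → ℝ} {s : Set ℝ} {a : ℝ}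
    (hφ : AnalyticOnNhd ℝ φ s) (hs : IsPreconnected s) (ha : a ∈ s)
    (h0 : ∀ k, iteratedDeriv k φ a = 0) : EqOn φ 0 s := by
  refine hφ.eqOn_zero_of_preconnected_of_eventuallyEq_zero hs ha ?_
  have htop : analyticOrderAt φ a = ⊤ := ENat.eq_top_iff_forall_ge.2 fun k =>
    (natCast_le_analyticOrderAt_iff_iteratedDeriv_eq_zero (hφ a ha)).2 fun i _ => h0 i
  exact analyticOrderAt_eq_top.1 htop

/-- If all derivatives in direction `v` of an analytic function vanish at `x`, then the function
vanishes along the line through `x` in direction `v`. -/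
theorem eq_zero_on_line {v : X} {f : X → ℝ} {s : Set X} (hf : AnalyticOnNhd ℝ f s) {x : X}
    {I : Set ℝ} (hI : IsOpen I) (hI' : IsPreconnected I) (h0I : (0 : ℝ) ∈ I)
    (hIs : ∀ t ∈ I, x + t • v ∈ s) (h0 : ∀ k, iterDirDeriv v f k x = 0) :
    ∀ t ∈ I, f (x + t • v) = 0 := by
  have hφ : AnalyticOnNhd ℝ (fun t : ℝ => f (x + t • v)) I := by
    intro t ht
    have h1 : AnalyticAt ℝ (fun u : ℝ => x + u • v) t := by fun_prop
    exact AnalyticAt.fun_comp (f := fun u : ℝ => x + u • v) (hf _ (hIs t ht)) h1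
  have hder : ∀ k, iteratedDeriv k (fun t : ℝ => f (x + t • v)) =ᶠ[𝓝 0]
      fun t => iterDirDeriv v f k (x + t • v) := by
    intro k
    induction k with
    | zero => simp [iterDirDeriv]
    | succ k ih =>
      rw [iteratedDeriv_succ]
      refine ih.deriv.trans ?_
      filter_upwards [hI.mem_nhds h0I] with t ht
      exact (hasDerivAt_iterDirDeriv hf k (hIs t ht)).deriv
  refine eqOn_zero_of_iteratedDeriv_eq_zero hφ hI' h0I fun k => ?_
  rw [(hder k).eq_of_nhds]
  simpa using h0 k

end Directional

/-! ### Boxes around points of a flattened hypersurface -/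

section Flattening

variable {X Y : Type*} [TopologicalSpace X] [NormedAddCommGroup Y]

/-- The preimage under `Φ` of the ball of radius `r` about `Φ q`. As `Y × ℝ` has the sup norm, it
is a box in the coordinates `Φ`. -/
def box (Φ : X ≃ₜ Y × ℝ) (q : X) (r : ℝ) : Set X := Φ ⁻¹' ball (Φ q) r

variable {Φ : X ≃ₜ Y × ℝ} {q x : X} {r : ℝ}

theorem mem_box_self (hr : 0 < r) : q ∈ box Φ q r := mem_ball_self hr

theorem isOpen_box : IsOpen (box Φ q r) := isOpen_ball.preimage Φ.continuous

theorem exists_box_subset {W : Set X} (hW : W ∈ 𝓝 q) : ∃ r > 0, box Φ q r ⊆ W := by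
  have h : Φ.symm ⁻¹' W ∈ 𝓝 (Φ q) :=
    Φ.symm.continuous.continuousAt.preimage_mem_nhds (by simpa using hW)
  obtain ⟨r, hr, h⟩ := Metric.mem_nhds_iff.1 h
  exact ⟨r, hr, fun x hx => by simpa using h hx⟩

theorem mem_box (hq : (Φ q).2 = 0) :
    x ∈ box Φ q r ↔ dist (Φ x).1 (Φ q).1 < r ∧ |(Φ x).2| < r := by
  rw [box, mem_preimage, mem_ball, Prod.dist_eq, max_lt_iff, hq, Real.dist_eq, sub_zero]

theorem symm_mem_box (hq : (Φ q).2 = 0) (hx : x ∈ box Φ q r) {t : ℝ} (ht : |t| < r) :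
    Φ.symm ((Φ x).1, t) ∈ box Φ q r := by
  rw [mem_box hq] at hx ⊢
  simpa using ⟨hx.1, ht⟩

variable [NormedSpace ℝ Y]

theorem isConnected_preimage_of_convex (Φ : X ≃ₜ Y × ℝ) {s : Set (Y × ℝ)} (hs : Convex ℝ s)
    (hne : s.Nonempty) : IsConnected (Φ ⁻¹' s) := by
  rw [← Φ.image_symm]
  exact ⟨hne.image _, hs.isPreconnected.image _ Φ.symm.continuous.continuousOn⟩

theorem isConnected_box (hr : 0 < r) : IsConnected (box Φ q r) :=
  isConnected_preimage_of_convex Φ (convex_ball _ _) ⟨_, mem_ball_self hr⟩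

theorem isConnected_box_upper (hq : (Φ q).2 = 0) (hr : 0 < r) :
    IsConnected (box Φ q r ∩ {x | 0 < (Φ x).2}) := by
  refine isConnected_preimage_of_convex Φ (s := ball (Φ q) r ∩ {p | 0 < p.2})
    ((convex_ball _ _).inter ?_) ⟨((Φ q).1, r / 2), ?_, ?_⟩
  · exact convex_halfSpace_gt (LinearMap.snd ℝ Y ℝ).isLinear 0
  · rw [mem_ball, Prod.dist_eq, hq]
    simp [abs_of_pos hr, hr]
  · simpa using hr

theorem isConnected_box_lower (hq : (Φ q).2 = 0) (hr : 0 < r) :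
    IsConnected (box Φ q r ∩ {x | (Φ x).2 < 0}) := by
  refine isConnected_preimage_of_convex Φ (s := ball (Φ q) r ∩ {p | p.2 < 0})
    ((convex_ball _ _).inter ?_) ⟨((Φ q).1, -(r / 2)), ?_, ?_⟩
  · exact convex_halfSpace_lt (LinearMap.snd ℝ Y ℝ).isLinear 0
  · rw [mem_ball, Prod.dist_eq, hq]
    simp [abs_of_pos hr, hr]
  · simpa using hr

/-- Every point of the hypersurface is a limit of points above it and of points below it. -/
theorem mem_closure_upper_lower (hx : (Φ x).2 = 0) {W : Set X} (hW : W ∈ 𝓝 x) :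
    (W ∩ {y | 0 < (Φ y).2}).Nonempty ∧ (W ∩ {y | (Φ y).2 < 0}).Nonempty := by
  obtain ⟨r, hr, h⟩ := exists_box_subset (Φ := Φ) hW
  exact ⟨(isConnected_box_upper hx hr).nonempty.mono (inter_subset_inter_left _ h),
    (isConnected_box_lower hx hr).nonempty.mono (inter_subset_inter_left _ h)⟩

/-- An open set is not contained in the hypersurface `(Φ x).2 = 0`. -/
theorem exists_mem_snd_ne_zero {W : Set X} (hW : IsOpen W) (hne : W.Nonempty) :
    ∃ x ∈ W, (Φ x).2 ≠ 0 := by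
  obtain ⟨x, hx⟩ := hne
  by_contra! h
  obtain ⟨y, hy, hy'⟩ := (mem_closure_upper_lower (h x hx) (hW.mem_nhds hx)).1
  exact hy'.ne' (h y hy)

end Flattening

/-! ### The sign of an analytic function on one side of a hypersurface -/

section Sign

variable {X Y : Type*} [NormedAddCommGroup X] [NormedSpace ℝ X]
  [NormedAddCommGroup Y] {Φ : X ≃ₜ Y × ℝ} {v : X}

/-- Let `g (j + 1)` be the derivative of `g j` in the vertical direction. If `g k` is positive and
all earlier `g j` vanish on the hypersurface, then `g 0` is positive above it: descending from
`k`, each `g j` vanishes on the hypersurface and increases along vertical segments. -/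
theorem pos_on_upper_of_iterated_deriv (hΦ : ∀ y s, Φ.symm (y, s) = Φ.symm (y, 0) + s • v)
    {q : X} (hq : (Φ q).2 = 0) {r : ℝ} {g : ℕ → X → ℝ}
    (hg : ∀ j x t, x + t • v ∈ box Φ q r →
      HasDerivAt (fun u : ℝ => g j (x + u • v)) (g (j + 1) (x + t • v)) t)
    {k : ℕ} (hk : ∀ x ∈ box Φ q r, 0 < g k x)
    (h0 : ∀ j < k, ∀ x ∈ box Φ q r, (Φ x).2 = 0 → g j x = 0) :
    ∀ x ∈ box Φ q r ∩ {x | 0 < (Φ x).2}, 0 < g 0 x := by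
  suffices H : ∀ i ≤ k, ∀ x ∈ box Φ q r ∩ {x | 0 < (Φ x).2}, 0 < g (k - i) x by
    simpa using H k le_rfl
  intro i
  induction i with
  | zero => exact fun _ x hx => by simpa using hk x hx.1
  | succ i ih =>
    rintro hi x ⟨hx, hx0⟩
    have hx0 : 0 < (Φ x).2 := hx0
    set y := Φ.symm ((Φ x).1, 0) with hy
    have hline : ∀ s, Φ.symm ((Φ x).1, s) = y + s • v := fun s => hΦ _ s
    have hxy : x = y + (Φ x).2 • v := by rw [← hline]; simp
    have hxr : (Φ x).2 < r := (le_abs_self _).trans_lt ((mem_box hq).1 hx).2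
    have hmem : ∀ s ∈ Icc 0 (Φ x).2, y + s • v ∈ box Φ q r := fun s hs => by
      rw [← hline]
      exact symm_mem_box hq hx (by rw [abs_of_nonneg hs.1]; exact hs.2.trans_lt hxr)
    have hmono : StrictMonoOn (fun u : ℝ => g (k - (i + 1)) (y + u • v)) (Icc 0 (Φ x).2) := by
      refine strictMonoOn_of_deriv_pos (convex_Icc _ _)
        (fun s hs => (hg _ y s (hmem s hs)).continuousAt.continuousWithinAt) fun s hs => ?_
      rw [interior_Icc] at hs
      rw [(hg _ y s (hmem s (Ioo_subset_Icc_self hs))).deriv,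
        show k - (i + 1) + 1 = k - i by omega]
      refine ih (by omega) _ ⟨hmem s (Ioo_subset_Icc_self hs), ?_⟩
      rw [← hline]
      simpa using hs.1
    have hlt := hmono (left_mem_Icc.2 hx0.le) (right_mem_Icc.2 hx0.le) hx0
    have hy0 : g (k - (i + 1)) y = 0 :=
      h0 _ (by omega) y (by simpa using hmem 0 (left_mem_Icc.2 hx0.le)) (by simp [hy])
    simp only [zero_smul, add_zero, hy0, ← hxy] at hlt
    exact hlt

/-- An analytic function that does not vanish near a point `q` of a hypersurface has a strict sign
on one side of the hypersurface, near a suitable point of it close to `q`. -/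
theorem exists_box_sign (hΦ : ∀ y s, Φ.symm (y, s) = Φ.symm (y, 0) + s • v)
    {f : X → ℝ} {W : Set X} (hf : AnalyticOnNhd ℝ f W) (hW : IsOpen W) {q : X} (hqW : q ∈ W)
    (hq : (Φ q).2 = 0) (hnz : ¬ ∀ᶠ x in 𝓝 q, f x = 0) :
    ∃ p r, (Φ p).2 = 0 ∧ 0 < r ∧ box Φ p r ⊆ W ∧
      ((∀ x ∈ box Φ p r ∩ {x | 0 < (Φ x).2}, 0 < f x) ∨
        (∀ x ∈ box Φ p r ∩ {x | 0 < (Φ x).2}, f x < 0)) := by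
  obtain ⟨r, hr, hrW⟩ := exists_box_subset (Φ := Φ) (hW.mem_nhds hqW)
  have hex : ∃ k, ∃ p ∈ box Φ q r, (Φ p).2 = 0 ∧ iterDirDeriv v f k p ≠ 0 := by
    by_contra! h
    refine hnz ?_
    filter_upwards [isOpen_box.mem_nhds (mem_box_self (Φ := Φ) (q := q) hr)] with x hx
    have hx' := (mem_box hq).1 hx
    have h0 : Φ.symm ((Φ x).1, 0) ∈ box Φ q r := symm_mem_box hq hx (by simpa using hr)
    have := eq_zero_on_line (v := v) hf (x := Φ.symm ((Φ x).1, 0)) (I := Ioo (-r) r) isOpen_Ioo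
      isPreconnected_Ioo (by simpa using hr)
      (fun t ht => by
        rw [← hΦ]
        exact hrW (symm_mem_box hq hx (abs_lt.2 ht)))
      (fun k => h k _ h0 (by simp)) (Φ x).2 (abs_lt.1 hx'.2)
    rwa [← hΦ, Prod.mk.eta, Φ.symm_apply_apply] at this
  classical
  obtain ⟨p, hp, hp0, hpk⟩ := Nat.find_spec hex
  have hmin : ∀ j < Nat.find hex, ∀ x ∈ box Φ q r, (Φ x).2 = 0 → iterDirDeriv v f j x = 0 := by
    intro j hj x hx hx0
    by_contra hne
    exact Nat.find_min hex hj ⟨x, hx, hx0, hne⟩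
  set k := Nat.find hex
  have hcont : ContinuousAt (iterDirDeriv v f k) p :=
    (analyticOnNhd_iterDirDeriv hf k p (hrW hp)).continuousAt
  rcases lt_or_gt_of_ne hpk with hneg | hpos
  · obtain ⟨ρ, hρ, hsub⟩ := exists_box_subset (Φ := Φ)
      (inter_mem (isOpen_box.mem_nhds hp) (hcont.eventually_lt_const hneg))
    refine ⟨p, ρ, hp0, hρ, fun x hx => hrW (hsub hx).1, Or.inr ?_⟩
    have := pos_on_upper_of_iterated_deriv hΦ hp0 (r := ρ) (g := fun j x => -iterDirDeriv v f j x)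
      (fun j x t hx => (hasDerivAt_iterDirDeriv hf j (hrW (hsub hx).1)).neg)
      (k := k) (fun x hx => neg_pos.2 (hsub hx).2)
      (fun j hj x hx hx0 => neg_eq_zero.2 (hmin j hj x (hsub hx).1 hx0))
    exact fun x hx => neg_pos.1 (this x hx)
  · obtain ⟨ρ, hρ, hsub⟩ := exists_box_subset (Φ := Φ)
      (inter_mem (isOpen_box.mem_nhds hp) (hcont.eventually_const_lt hpos))
    refine ⟨p, ρ, hp0, hρ, fun x hx => hrW (hsub hx).1, Or.inl ?_⟩
    exact pos_on_upper_of_iterated_deriv hΦ hp0 (r := ρ) (g := iterDirDeriv v f)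
      (fun j x t hx => hasDerivAt_iterDirDeriv hf j (hrW (hsub hx).1))
      (k := k) (fun x hx => (hsub hx).2)
      (fun j hj x hx hx0 => hmin j hj x (hsub hx).1 hx0)

end Sign

/-! ### Smooth boundary pieces -/

section Pieces

variable {n : ℕ}

/-- The homeomorphism `x ↦ (x', xₙ - γ(x'))`, which maps the graph of `γ` in the coordinates `e`
to the hyperplane of points with last component `0`. -/
noncomputable def flatten (e : Coordinates n) {γ : E (n - 1) → ℝ} (hγ : Continuous γ) :
    E n ≃ₜ E (n - 1) × ℝ where
  toFun x := ((e x).fst, (e x).snd - γ (e x).fst)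
  invFun p := e.symm (WithLp.toLp 2 (p.1, p.2 + γ p.1))
  left_inv x := by
    simp only [sub_add_cancel]
    exact e.symm_apply_apply x
  right_inv p := by simp
  continuous_toFun := by
    have h : Continuous fun x => WithLp.ofLp (e x) :=
      (WithLp.prod_continuous_ofLp 2 _ _).comp e.continuous
    have h1 : Continuous fun x => (e x).fst := continuous_fst.comp h
    have h2 : Continuous fun x => (e x).snd := continuous_snd.comp h
    exact h1.prodMk (h2.sub (hγ.comp h1))
  continuous_invFun := by
    refine e.symm.continuous.comp ((WithLp.prod_continuous_toLp 2 _ _).comp ?_)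
    fun_prop

theorem flatten_snd (e : Coordinates n) {γ : E (n - 1) → ℝ} (hγ : Continuous γ) (x : E n) :
    (flatten e hγ x).2 = (e x).snd - γ (e x).fst := rfl

theorem flatten_symm_eq (e : Coordinates n) {γ : E (n - 1) → ℝ} (hγ : Continuous γ)
    (y : E (n - 1)) (s : ℝ) : (flatten e hγ).symm (y, s) =
      (flatten e hγ).symm (y, 0) + s • e.symm (WithLp.toLp 2 (0, 1)) := by
  change e.symm (WithLp.toLp 2 (y, s + γ y)) = e.symm (WithLp.toLp 2 (y, 0 + γ y)) + _
  rw [← map_smul, ← map_add, ← WithLp.toLp_smul, ← WithLp.toLp_add]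
  simp [add_comm]

/-- A smooth boundary piece, in coordinates that flatten it. -/
theorem IsSmoothBoundaryPiece.exists_flatten {O Γ : Set (E n)} (h : IsSmoothBoundaryPiece O Γ) :
    ∃ (Φ : E n ≃ₜ E (n - 1) × ℝ) (v : E n) (W : Set (E n)),
      (∀ y s, Φ.symm (y, s) = Φ.symm (y, 0) + s • v) ∧ IsOpen W ∧ Γ ⊆ frontier O ∧
      (∀ x, x ∈ Γ ↔ x ∈ W ∧ (Φ x).2 = 0) ∧ (∀ x ∈ W, x ∈ frontier O ↔ (Φ x).2 = 0) ∧
      ∀ x ∈ W, x ∈ O ↔ 0 < (Φ x).2 := by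
  obtain ⟨W, e, γ, hW, hγ, rfl, h1, h2⟩ := h
  have key1 := fun x => Set.ext_iff.1 h1 x
  have key2 := fun x => Set.ext_iff.1 h2 x
  refine ⟨flatten e hγ.continuous, _, W, flatten_symm_eq e hγ.continuous, hW,
    inter_subset_left, fun x => ?_, fun x hx => ?_, fun x hx => ?_⟩
  · rw [key1 x, flatten_snd, sub_eq_zero]; rfl
  · rw [flatten_snd, sub_eq_zero]; simpa [hx] using key1 x
  · rw [flatten_snd, sub_pos]; simpa [hx] using key2 x

theorem volume_snd_eq_zero {Φ : E n ≃ₜ E (n - 1) × ℝ} {v : E n}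
    (hΦ : ∀ y s, Φ.symm (y, s) = Φ.symm (y, 0) + s • v) : volume {x | (Φ x).2 = 0} = 0 := by
  have hadd : ∀ x s, (Φ x).2 = 0 → (Φ (s • v + x)).2 = s := fun x s hx => by
    have h := hΦ (Φ x).1 s
    rw [← hx, Prod.mk.eta, Φ.symm_apply_apply] at h
    rw [add_comm, ← h]
    simp
  -- The vertical translates of the hypersurface by distinct heights are disjoint.
  refine Measure.addHaar_eq_zero_of_disjoint_translates volume
    (fun k : ℕ => ((k : ℝ) + 1)⁻¹ • v) ?_ ?_ ?_
  · refine (isBounded_iff_forall_norm_le).2 ⟨‖v‖, ?_⟩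
    rintro _ ⟨k, rfl⟩
    rw [norm_smul, Real.norm_of_nonneg (by positivity)]
    exact mul_le_of_le_one_left (norm_nonneg v) (inv_le_one_of_one_le₀ (by simp))
  · intro i j hij
    refine Set.disjoint_left.2 ?_
    simp only [singleton_add, mem_image, mem_ofPred_eq]
    rintro _ ⟨x, hx, rfl⟩ ⟨y, hy, hxy⟩
    have h1 := hadd x ((i : ℝ) + 1)⁻¹ hx
    rw [← hxy, hadd y _ hy] at h1
    exact hij (by simpa using h1.symm)
  · exact (isClosed_singleton.preimage (continuous_snd.comp Φ.continuous)).measurableSet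

theorem closure_subset_snd_eq_zero {Φ : E n ≃ₜ E (n - 1) × ℝ} {Γ : Set (E n)}
    (h : ∀ x ∈ Γ, (Φ x).2 = 0) : closure Γ ⊆ {x | (Φ x).2 = 0} :=
  closure_minimal h (isClosed_singleton.preimage (continuous_snd.comp Φ.continuous))

theorem HasPiecewiseSmoothBoundary.volume_frontier {O : Set (E n)}
    (h : HasPiecewiseSmoothBoundary O) : volume (frontier O) = 0 := by
  obtain ⟨S, hS, hΓ, heq⟩ := h
  rw [heq, measure_biUnion_null_iff hS]
  intro Γ hΓS
  obtain ⟨Φ, v, W, hΦ, -, -, hΓW, -⟩ := (hΓ Γ hΓS).exists_flatten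
  exact measure_mono_null (closure_subset_snd_eq_zero fun x hx => ((hΓW x).1 hx).2)
    (volume_snd_eq_zero hΦ)

/-- As a set with smooth boundary is locally one side of a graph, it meets suitable arbitrarily
small neighbourhoods of a boundary point `p` in a connected set, and `p` is a limit of exterior
points. -/
theorem HasSmoothBoundary.exists_nhds {O : Set (E n)} (h : HasSmoothBoundary O)
    {p : E n} (hp : p ∈ frontier O) {G : Set (E n)} (hG : G ∈ 𝓝 p) :
    (∃ B, IsOpen B ∧ p ∈ B ∧ B ⊆ G ∧ IsConnected (B ∩ O)) ∧ p ∈ closure (closure O)ᶜ := by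
  obtain ⟨S, hS, heq⟩ := h
  rw [heq] at hp
  obtain ⟨Γ, hΓS, hpΓ⟩ := hp
  obtain ⟨Φ, v, W, -, hW, -, hΓ, hfr, hO⟩ := (hS Γ hΓS).exists_flatten
  obtain ⟨hpW, hp0⟩ := (hΓ p).1 hpΓ
  refine ⟨?_, ?_⟩
  · obtain ⟨r, hr, hsub⟩ := exists_box_subset (Φ := Φ) (inter_mem hG (hW.mem_nhds hpW))
    refine ⟨box Φ p r, isOpen_box, mem_box_self hr, fun x hx => (hsub hx).1, ?_⟩
    convert isConnected_box_upper hp0 hr using 1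
    ext x
    exact and_congr_right fun hx => hO x (hsub hx).2
  · rw [mem_closure_iff_nhds]
    intro t ht
    obtain ⟨y, hy, hy0⟩ := (mem_closure_upper_lower hp0 (inter_mem ht (hW.mem_nhds hpW))).2
    have hy0 : (Φ y).2 < 0 := hy0
    refine ⟨y, hy.1, fun hc => ?_⟩
    rw [closure_eq_self_union_frontier] at hc
    rcases hc with hc | hc
    · exact absurd ((hO y hy.2).1 hc) hy0.not_gt
    · exact hy0.ne ((hfr y hy.2).1 hc)

end Pieces

/-! ### One-sided contact of two open sets -/

section Contact

variable {n : ℕ}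

/-- Baire's theorem: if the boundary of `A` inside an open set `K` is covered by countably many
closed sets, one of them covers the boundary of `A` near some point. -/
theorem exists_frontier_subset_of_countable_cover {X ι : Type*} [TopologicalSpace X] [T2Space X]
    [LocallyCompactSpace X] [Countable ι] {A K : Set X} (hK : IsOpen K)
    (hne : (K ∩ frontier A).Nonempty) {C : ι → Set X} (hC : ∀ i, IsClosed (C i))
    (hcov : K ∩ frontier A ⊆ ⋃ i, C i) :
    ∃ i, ∃ x ∈ frontier A, ∃ K', IsOpen K' ∧ x ∈ K' ∧ K' ⊆ K ∧ K' ∩ frontier A ⊆ C i := by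
  have : LocallyCompactSpace ↥(K ∩ frontier A) :=
    (hK.isLocallyClosed.inter isClosed_frontier.isLocallyClosed).locallyCompactSpace
  have : Nonempty ↥(K ∩ frontier A) := hne.to_subtype
  obtain ⟨i, x, hx⟩ := nonempty_interior_of_iUnion_of_closed
    (f := fun i => ((↑) : ↥(K ∩ frontier A) → X) ⁻¹' C i)
    (fun i => (hC i).preimage continuous_subtype_val) (by
      rw [← preimage_iUnion]
      exact eq_univ_of_forall fun x => hcov x.2)
  obtain ⟨t, ht, hto, hxt⟩ := mem_interior.1 hx
  obtain ⟨K₁, hK₁, rfl⟩ := isOpen_induced_iff.1 hto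
  exact ⟨i, x, x.2.2, K₁ ∩ K, hK₁.inter hK, ⟨hxt, x.2.1⟩, inter_subset_right,
    fun y hy => ht (a := ⟨y, hy.1.2, hy.2⟩) hy.1.1⟩

theorem subset_or_disjoint_of_disjoint_frontier {X : Type*} [TopologicalSpace X] {s A : Set X}
    (hs : IsPreconnected s) (hA : IsOpen A) (h : ∀ x ∈ s, x ∉ frontier A) :
    s ⊆ A ∨ Disjoint s A := by
  have := isPreconnected_iff_subset_of_disjoint.1 hs A (closure A)ᶜ hA isClosed_closure.isOpen_compl
    (fun x hx => by
      by_cases hxA : x ∈ closure A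
      · exact Or.inl (by_contra fun h' => h x hx ⟨hxA, by rwa [hA.interior_eq]⟩)
      · exact Or.inr hxA)
    (by
      ext x
      simp only [mem_inter_iff, mem_compl_iff, mem_empty_iff_false, iff_false]
      exact fun hx => hx.2.2 (subset_closure hx.2.1))
  exact this.imp id fun h' =>
    Set.disjoint_left.2 fun x hx hxA => h' hx (subset_closure hxA)

/-- If, near a point `x`, the boundary of an open set `A` is contained in a hypersurface, and both
`A` and the complement of `A` contain interior points near `x`, then the whole hypersurface is
boundary of `A` near `x`, and `A` lies on exactly one side of it. -/
theorem one_sided_of_frontier_subset {X Y : Type*} [TopologicalSpace X] [NormedAddCommGroup Y]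
    [NormedSpace ℝ Y] {Φ : X ≃ₜ Y × ℝ} {A N : Set X} (hA : IsOpen A) (hN : IsOpen N)
    (hAN : Disjoint A N) {x : X} (hx : (Φ x).2 = 0) {r : ℝ} (hr : 0 < r)
    (hfr : ∀ y ∈ box Φ x r, y ∈ frontier A → (Φ y).2 = 0)
    (hxA : x ∈ closure A) (hxN : x ∈ closure N) :
    (∀ y ∈ box Φ x r, (Φ y).2 = 0 → y ∈ frontier A) ∧
      ((∀ y ∈ box Φ x r, y ∈ A ↔ (Φ y).2 < 0) ∨ (∀ y ∈ box Φ x r, y ∈ A ↔ 0 < (Φ y).2)) := by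
  have hmeet : ∀ {s : Set X}, IsOpen s → x ∈ closure s →
      ∃ y ∈ box Φ x r, y ∈ s ∧ (Φ y).2 ≠ 0 := by
    intro s hs hxs
    obtain ⟨y, hy, hy0⟩ := exists_mem_snd_ne_zero (Φ := Φ) (isOpen_box.inter hs)
      (mem_closure_iff.1 hxs _ isOpen_box (mem_box_self (Φ := Φ) hr))
    exact ⟨y, hy.1, hy.2, hy0⟩
  obtain ⟨a, haB, haA, ha0⟩ := hmeet hA hxA
  obtain ⟨b, hbB, hbN, hb0⟩ := hmeet hN hxN
  have hbA : b ∉ A := fun h => Set.disjoint_left.1 hAN h hbN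
  have hup := subset_or_disjoint_of_disjoint_frontier (isConnected_box_upper hx hr).isPreconnected
    hA fun y hy hyf => (mem_ofPred.1 hy.2).ne' (hfr y hy.1 hyf)
  have hlo := subset_or_disjoint_of_disjoint_frontier (isConnected_box_lower hx hr).isPreconnected
    hA fun y hy hyf => (mem_ofPred.1 hy.2).ne (hfr y hy.1 hyf)
  have hcases : ((box Φ x r ∩ {y | 0 < (Φ y).2} ⊆ A) ∧ Disjoint (box Φ x r ∩ {y | (Φ y).2 < 0}) A)
      ∨ ((box Φ x r ∩ {y | (Φ y).2 < 0} ⊆ A) ∧ Disjoint (box Φ x r ∩ {y | 0 < (Φ y).2}) A) := by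
    rcases hup with h1 | h1 <;> rcases hlo with h2 | h2
    · rcases lt_or_gt_of_ne hb0 with h | h
      · exact absurd (h2 ⟨hbB, h⟩) hbA
      · exact absurd (h1 ⟨hbB, h⟩) hbA
    · exact Or.inl ⟨h1, h2⟩
    · exact Or.inr ⟨h2, h1⟩
    · rcases lt_or_gt_of_ne ha0 with h | h
      · exact absurd haA (Set.disjoint_left.1 h2 ⟨haB, h⟩)
      · exact absurd haA (Set.disjoint_left.1 h1 ⟨haB, h⟩)
  have hS : ∀ y ∈ box Φ x r, (Φ y).2 = 0 → y ∈ frontier A := by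
    intro y hy hy0
    have hcl : ∀ {s t : Set X}, (∀ u ∈ 𝓝 y, (u ∩ s).Nonempty) → box Φ x r ∩ s ⊆ t →
        y ∈ closure t := by
      intro s t hs hst
      rw [mem_closure_iff_nhds]
      intro u hu
      obtain ⟨z, hz, hzs⟩ := hs _ (inter_mem hu (isOpen_box.mem_nhds hy))
      exact ⟨z, hz.1, hst ⟨hz.2, hzs⟩⟩
    rw [frontier_eq_closure_inter_closure]
    rcases hcases with ⟨h1, h2⟩ | ⟨h1, h2⟩
    · exact ⟨hcl (fun u hu => (mem_closure_upper_lower hy0 hu).1) h1,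
        hcl (fun u hu => (mem_closure_upper_lower hy0 hu).2) h2.subset_compl_right⟩
    · exact ⟨hcl (fun u hu => (mem_closure_upper_lower hy0 hu).2) h1,
        hcl (fun u hu => (mem_closure_upper_lower hy0 hu).1) h2.subset_compl_right⟩
  have hSA : ∀ y ∈ box Φ x r, y ∈ A → (Φ y).2 ≠ 0 := fun y hy hyA hy0 =>
    (hS y hy hy0).2 (by rwa [hA.interior_eq])
  refine ⟨hS, ?_⟩
  rcases hcases with ⟨h1, h2⟩ | ⟨h1, h2⟩
  · refine Or.inr fun y hy => ⟨fun hyA => ?_, fun h => h1 ⟨hy, h⟩⟩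
    exact (lt_or_gt_of_ne (hSA y hy hyA)).resolve_left
      fun h => Set.disjoint_left.1 h2 ⟨hy, h⟩ hyA
  · refine Or.inl fun y hy => ⟨fun hyA => ?_, fun h => h1 ⟨hy, h⟩⟩
    exact (lt_or_gt_of_ne (hSA y hy hyA)).resolve_right
      fun h => Set.disjoint_left.1 h2 ⟨hy, h⟩ hyA

/-- Let the boundary of `A` inside an open set `K` be covered by the boundaries of countably many
domains `O i` disjoint from `A`, each carrying an analytic function `f i` that does not vanish
identically. Then some small neighbourhood `B` of some boundary point of `A` in `K` is divided by
the boundary of `A` into a part of `A` and a connected part of a single `O i`, and `f i` has a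
strict sign on the latter. -/
theorem exists_contact_nhds {ι : Type*} [Countable ι] {O : ι → Set (E n)} {f : ι → E n → ℝ}
    (hO : ∀ i, IsOpen (O i)) (hc : ∀ i, IsPreconnected (O i))
    (hb : ∀ i, HasPiecewiseSmoothBoundary (O i)) (hf : ∀ i, AnalyticOnNhd ℝ (f i) (closure (O i)))
    (hnz : ∀ i, ∃ x ∈ O i, f i x ≠ 0) {A K : Set (E n)} (hA : IsOpen A)
    (hAO : ∀ i, Disjoint A (O i)) (hK : IsOpen K) (hne : (K ∩ frontier A).Nonempty)
    (hcov : K ∩ frontier A ⊆ ⋃ i, frontier (O i)) :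
    ∃ i q B, q ∈ frontier A ∧ q ∈ B ∧ IsOpen B ∧ B ⊆ K ∧ IsConnected B ∧ IsConnected (B ∩ O i) ∧
      B ⊆ A ∪ frontier A ∪ O i ∧
      ((∀ x ∈ B ∩ O i, 0 < f i x) ∨ (∀ x ∈ B ∩ O i, f i x < 0)) := by
  choose S hScount hSpiece hSeq using hb
  have := fun i => (hScount i).to_subtype
  obtain ⟨⟨i, Γ, hΓS⟩, x, hxA, K', hK', hxK', hK'K, hsub⟩ :=
    exists_frontier_subset_of_countable_cover hK hne
      (C := fun j : Σ i, ↥(S i) => closure (j.2 : Set (E n))) (fun _ => isClosed_closure) (by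
        refine hcov.trans (iUnion_subset fun i => ?_)
        rw [hSeq i]
        exact iUnion₂_subset fun Γ hΓ =>
          subset_iUnion (fun j : Σ i, ↥(S i) => closure (j.2 : Set (E n))) ⟨i, Γ, hΓ⟩)
  obtain ⟨Φ, v, W, hΦ, hW, hΓO, hΓ, -, hOW⟩ := (hSpiece i Γ hΓS).exists_flatten
  have hclΓ := closure_subset_snd_eq_zero (Φ := Φ) fun x hx => ((hΓ x).1 hx).2
  have hxΓ : x ∈ closure Γ := hsub ⟨hxK', hxA⟩
  have hx0 : (Φ x).2 = 0 := hclΓ hxΓ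
  obtain ⟨r, hr, hrK'⟩ := exists_box_subset (Φ := Φ) (hK'.mem_nhds hxK')
  obtain ⟨hgraph, hside⟩ := one_sided_of_frontier_subset (Φ := Φ) hA (hO i) (hAO i) hx0 hr
    (fun y hy hyA => hclΓ (hsub ⟨hrK' hy, hyA⟩)) (frontier_subset_closure hxA)
    (closure_minimal (hΓO.trans frontier_subset_closure) isClosed_closure hxΓ)
  obtain ⟨q, hqB, hqΓ⟩ := mem_closure_iff.1 hxΓ _ isOpen_box (mem_box_self (Φ := Φ) hr)
  obtain ⟨hqW, hq0⟩ := (hΓ q).1 hqΓ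
  have hqO : q ∈ closure (O i) := frontier_subset_closure (hΓO hqΓ)
  have hqf : AnalyticAt ℝ (f i) q := hf i q hqO
  have hlower : ∀ y ∈ box Φ x r, (Φ y).2 < 0 → y ∈ A := by
    rcases hside with h | h
    · exact fun y hy => (h y hy).2
    · -- `A` above the hypersurface would meet `O i` near `q`.
      obtain ⟨y, hy, hy0⟩ := (mem_closure_upper_lower hq0
        (inter_mem (isOpen_box.mem_nhds hqB) (hW.mem_nhds hqW))).1
      exact absurd ((hOW y hy.2).2 hy0) (Set.disjoint_left.1 (hAO i) ((h y hy.1).2 hy0))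
  have hfnz : ¬ ∀ᶠ y in 𝓝 q, f i y = 0 := by
    intro h
    obtain ⟨t, ht, hto, hqt⟩ := _root_.eventually_nhds_iff.1 h
    obtain ⟨z, hzt, hzO⟩ := mem_closure_iff.1 hqO t hto hqt
    obtain ⟨y, hy, hy0⟩ := hnz i
    exact hy0 (((hf i).mono subset_closure).eqOn_zero_of_preconnected_of_eventuallyEq_zero (hc i)
      hzO (eventually_of_mem (hto.mem_nhds hzt) ht) hy)
  obtain ⟨p, ρ, hp0, hρ, hpB, hsign⟩ := exists_box_sign (Φ := Φ) hΦ (f := f i)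
    (W := {y | AnalyticAt ℝ (f i) y} ∩ (box Φ x r ∩ W)) (fun y hy => hy.1)
    ((isOpen_analyticAt ℝ (f i)).inter (isOpen_box.inter hW)) ⟨hqf, hqB, hqW⟩ hq0 hfnz
  have hBO : box Φ p ρ ∩ O i = box Φ p ρ ∩ {y | 0 < (Φ y).2} := by
    ext y
    exact and_congr_right fun hy => hOW y (hpB hy).2.2
  refine ⟨i, p, box Φ p ρ, hgraph p (hpB (mem_box_self hρ)).2.1 hp0, mem_box_self hρ, isOpen_box,
    fun y hy => hK'K (hrK' (hpB hy).2.1), isConnected_box hρ, ?_, fun y hy => ?_, ?_⟩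
  · rw [hBO]
    exact isConnected_box_upper hp0 hρ
  · obtain ⟨-, hyB, hyW⟩ := hpB hy
    rcases lt_trichotomy (Φ y).2 0 with h | h | h
    · exact Or.inl (Or.inl (hlower y hyB h))
    · exact Or.inl (Or.inr (hgraph y hyB h))
    · exact Or.inr ((hOW y hyW).2 h)
  · rwa [hBO]

end Contact

/-! ### Piecewise analytic functions -/

section Main

variable {n : ℕ}

/-- The boundaries of the pieces are null sets, so almost every point lies in a piece. -/
theorem ae_exists_mem_piece {ι : Type*} [Finite ι] {Ω : Set (E n)} {O : ι → Set (E n)}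
    (hO : ∀ i, IsOpen (O i)) (hb : ∀ i, HasPiecewiseSmoothBoundary (O i))
    (hcl : closure Ω = closure (⋃ i, O i)) {σ : E n → ℝ} {f : ι → E n → ℝ}
    (hσ : ∀ i, ∀ᵐ x ∂volume.restrict (O i), σ x = f i x) :
    ∀ᵐ x, x ∈ Ω → ∃ i, x ∈ O i ∧ σ x = f i x := by
  have h1 : ∀ᵐ x, ∀ i, x ∈ O i → σ x = f i x :=
    ae_all_iff.2 fun i => (ae_restrict_iff' (hO i).measurableSet).1 (hσ i)
  have h2 : ∀ᵐ x, ∀ i, x ∉ frontier (O i) :=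
    ae_all_iff.2 fun i => measure_eq_zero_iff_ae_notMem.1 (hb i).volume_frontier
  filter_upwards [h1, h2] with x hx1 hx2 hxΩ
  have hx : x ∈ ⋃ i, closure (O i) := by
    rw [← closure_iUnion_of_finite, ← hcl]
    exact subset_closure hxΩ
  obtain ⟨i, hi⟩ := mem_iUnion.1 hx
  rw [closure_eq_self_union_frontier] at hi
  have hi' := hi.resolve_right (hx2 i)
  exact ⟨i, hi', hx1 i hi'⟩

/-- A component of a proper open subset `H` of a preconnected set `G` has boundary points in `G`,
and none of its boundary points belongs to `H`. -/
theorem frontier_connectedComponentIn {X : Type*} [TopologicalSpace X] [LocallyConnectedSpace X]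
    {G H : Set X} (hG : IsPreconnected G) (hH : IsOpen H) (hHG : H ⊆ G) (hne : H ≠ G) {x : X}
    (hx : x ∈ H) : (G ∩ frontier (connectedComponentIn H x)).Nonempty ∧
      Disjoint H (frontier (connectedComponentIn H x)) := by
  have hZ : IsOpen (connectedComponentIn H x) := hH.connectedComponentIn
  refine ⟨?_, Set.disjoint_left.2 fun y hyH hy => ?_⟩
  · by_contra h
    rcases subset_or_disjoint_of_disjoint_frontier hG hZ fun y hy hyf => h ⟨y, hy, hyf⟩ with h | h
    · exact hne (hHG.antisymm (h.trans (connectedComponentIn_subset H x)))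
    · exact Set.disjoint_left.1 h (hHG hx) (mem_connectedComponentIn hx)
  · obtain ⟨z, hz, hzx⟩ := mem_closure_iff.1 (frontier_subset_closure hy) _
      (hH.connectedComponentIn (x := y)) (mem_connectedComponentIn hyH)
    have : y ∈ connectedComponentIn H x := by
      rw [connectedComponentIn_eq hzx, ← connectedComponentIn_eq hz]
      exact mem_connectedComponentIn hyH
    exact hy.2 (by rwa [hZ.interior_eq])

/-- If `σ` vanishes almost everywhere on `s` outside a nonempty open set `P`, and has a strict
sign almost everywhere on `P`, then it is nonzero and of one sign on `s`. -/
theorem not_ae_zero_and_definite {s P : Set (E n)} {σ f : E n → ℝ} (hs : MeasurableSet s)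
    (hP : IsOpen P) (hPne : P.Nonempty) (hPs : P ⊆ s)
    (hσ : ∀ᵐ x, x ∈ s → σ x = 0 ∧ x ∉ P ∨ x ∈ P ∧ σ x = f x)
    (hsign : (∀ x ∈ P, 0 < f x) ∨ (∀ x ∈ P, f x < 0)) :
    (¬ ∀ᵐ x ∂volume.restrict s, σ x = 0) ∧
      ((∀ᵐ x ∂volume.restrict s, 0 ≤ σ x) ∨ (∀ᵐ x ∂volume.restrict s, σ x ≤ 0)) := by
  simp only [ae_restrict_iff' hs]
  refine ⟨fun h => ?_, ?_⟩
  · refine (hP.measure_pos volume hPne).ne' (measure_eq_zero_iff_ae_notMem.2 ?_)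
    filter_upwards [h, hσ] with x hx0 hx hxP
    rcases hx (hPs hxP) with hx | hx
    · exact hx.2 hxP
    · have : f x = 0 := hx.2 ▸ hx0 (hPs hxP)
      rcases hsign with hs | hs
      · exact (hs x hxP).ne' this
      · exact (hs x hxP).ne this
  · refine hsign.imp (fun hs => ?_) (fun hs => ?_) <;>
    · filter_upwards [hσ] with x hx hxs
      rcases hx hxs with hx | hx
      · simp [hx.1]
      · rw [hx.2]
        exact (hs x hx.1).le

end Main

end PiecewiseAnalytic

open PiecewiseAnalytic Filter Topology in
theorem mainTheorem6 (n : ℕ) (hn : 2 ≤ n)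
    (Ω : Set (PiecewiseAnalytic.E n)) (hΩ : PiecewiseAnalytic.IsSmoothlyBoundedDomain Ω)
    (σ : PiecewiseAnalytic.E n → ℝ) (hσ : PiecewiseAnalytic.IsPiecewiseAnalytic Ω σ)
    (U : Set (PiecewiseAnalytic.E n)) (hU : PiecewiseAnalytic.IsRelOpen Ω U)
    (hUb : PiecewiseAnalytic.IsConnectedToBoundary Ω U)
    (hU0 : ¬ ∀ᵐ x ∂volume.restrict (U ∩ Ω), σ x = 0) :
    ∃ V : Set (PiecewiseAnalytic.E n), PiecewiseAnalytic.IsRelOpen Ω V ∧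
      PiecewiseAnalytic.IsConnectedToBoundary Ω V ∧ V ⊆ U ∧
      (¬ ∀ᵐ x ∂volume.restrict (V ∩ Ω), σ x = 0) ∧
      ((∀ᵐ x ∂volume.restrict (V ∩ Ω), 0 ≤ σ x) ∨
        (∀ᵐ x ∂volume.restrict (V ∩ Ω), σ x ≤ 0)) := by
  obtain ⟨-, M, O, hO, hdisj, hcl, hfex⟩ := hσ
  choose f hf hσf using hfex
  obtain ⟨G₀, hG₀, rfl⟩ := hU
  obtain ⟨hconn, p, ⟨hpG₀, -⟩, hpΩ⟩ := hUb
  have hΩo := hΩ.isOpen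
  have hUΩ : ∀ H : Set (E n), H ∩ closure Ω ∩ Ω = H ∩ Ω := fun H => by
    rw [inter_assoc, inter_eq_right.2 subset_closure]
  rw [hUΩ] at hconn hU0
  have hpiece := ae_exists_mem_piece (fun i => (hO i).1)
    (fun i => (hO i).2.2.2) hcl hσf
  -- The pieces on which `σ` does not vanish identically.
  let ι := {m : Fin M // ∃ x ∈ O m, f m x ≠ 0}
  let N : Set (E n) := ⋃ i : ι, O i
  have hclN : closure N = ⋃ i : ι, closure (O i) := closure_iUnion_of_finite _
  have hNΩ : N ⊆ Ω := iUnion_subset fun i => (hO i).2.2.1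
  have hNo : IsOpen N := isOpen_iUnion fun i => (hO i).1
  have hcover : ∀ x ∈ closure N, x ∉ N → x ∈ ⋃ i : ι, frontier (O i) := by
    intro x hx hxN
    rw [hclN] at hx
    obtain ⟨i, hi⟩ := mem_iUnion.1 hx
    refine mem_iUnion.2 ⟨i, hi, ?_⟩
    rw [(hO i).1.interior_eq]
    exact fun h => hxN (mem_iUnion.2 ⟨i, h⟩)
  have hzero : ∀ᵐ x, x ∈ Ω → σ x = 0 ∧ x ∉ N ∨ ∃ i : ι, x ∈ O i ∧ σ x = f i x := by
    filter_upwards [hpiece] with x hx hxΩ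
    obtain ⟨m, hm, hσx⟩ := hx hxΩ
    by_cases h : ∃ y ∈ O m, f m y ≠ 0
    · exact Or.inr ⟨⟨m, h⟩, hm, hσx⟩
    · refine Or.inl ⟨?_, fun hxN => ?_⟩
      · push Not at h
        rw [hσx, h x hm]
      · obtain ⟨i, hi⟩ := mem_iUnion.1 hxN
        have : (i : Fin M) = m := by
          by_contra hne
          exact Set.disjoint_left.1 (hdisj hne) hi hm
        exact h (this ▸ i.2)
  have hcontact := fun {A K : Set (E n)} => exists_contact_nhds (A := A) (K := K)
    (O := fun i : ι => O i) (f := fun i => f i) (fun i => (hO i).1)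
    (fun i => (hO i).2.1.isPreconnected) (fun i => (hO i).2.2.2) (fun i => hf i) (fun i => i.2)
  by_cases hbd : G₀ ∩ frontier Ω ⊆ closure N
  · -- The nonzero pieces cover the boundary of `Ω` in `U`: take the exterior of `Ω` for `A`.
    have hfrA : frontier (closure Ω)ᶜ ⊆ frontier Ω := by
      rw [frontier_compl]
      exact frontier_closure_subset
    obtain ⟨i, q, B, hqA, hqB, hB, hBG, -, hBO, hBsub, hsign⟩ :=
      hcontact (A := (closure Ω)ᶜ) (K := G₀) isClosed_closure.isOpen_compl
      (fun i => Set.disjoint_left.2 fun x hx hxi => hx (subset_closure ((hO i).2.2.1 hxi))) hG₀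
      ⟨p, hpG₀, (hΩ.hasSmoothBoundary.exists_nhds hpΩ (hG₀.mem_nhds hpG₀)).2, by
        rw [isClosed_closure.isOpen_compl.interior_eq]
        exact fun h => h (frontier_subset_closure hpΩ)⟩
      (fun x hx => hcover x (hbd ⟨hx.1, hfrA hx.2⟩) fun hxN => (hfrA hx.2).2 (by
        rw [hΩo.interior_eq]
        exact hNΩ hxN))
    have hBΩ : B ∩ Ω = B ∩ O i := by
      refine Subset.antisymm (fun x hx => ⟨hx.1, ?_⟩)
        (inter_subset_inter_right _ (hO i).2.2.1)
      rcases hBsub hx.1 with (h | h) | h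
      · exact absurd (subset_closure hx.2) h
      · exact absurd (by rw [hΩo.interior_eq]; exact hx.2) (hfrA h).2
      · exact h
    refine ⟨B ∩ closure Ω, ⟨B, hB, rfl⟩, ⟨?_, q, ⟨hqB, ?_⟩, hfrA hqA⟩,
      inter_subset_inter_left _ hBG, ?_⟩
    · rwa [hUΩ, hBΩ]
    · exact frontier_subset_closure (hfrA hqA)
    · rw [hUΩ, hBΩ]
      refine not_ae_zero_and_definite (hB.inter (hO i).1).measurableSet (hB.inter (hO i).1)
        hBO.nonempty Subset.rfl ?_ hsign
      filter_upwards [(ae_restrict_iff' (hO i).1.measurableSet).1 (hσf i)] with x hx hxB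
      exact Or.inr ⟨hxB, hx hxB.2⟩
  · -- Some boundary point in `U` is not a limit of points of the nonzero pieces: take for `A`
    -- the component of the region of zeros that touches this point.
    obtain ⟨p', ⟨hp'G, hp'Ω⟩, hp'N⟩ := not_subset.1 hbd
    obtain ⟨⟨B₀, hB₀, hp'B₀, hB₀sub, hB₀Ω⟩, -⟩ := hΩ.hasSmoothBoundary.exists_nhds hp'Ω
      ((hG₀.inter isClosed_closure.isOpen_compl).mem_nhds ⟨hp'G, hp'N⟩)
    obtain ⟨x₀, hx₀⟩ := hB₀Ω.nonempty
    have hHo : IsOpen (G₀ ∩ Ω ∩ (closure N)ᶜ) :=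
      (hG₀.inter hΩo).inter isClosed_closure.isOpen_compl
    have hB₀H : B₀ ∩ Ω ⊆ G₀ ∩ Ω ∩ (closure N)ᶜ := fun x hx =>
      ⟨⟨(hB₀sub hx.1).1, hx.2⟩, (hB₀sub hx.1).2⟩
    have hHne : G₀ ∩ Ω ∩ (closure N)ᶜ ≠ G₀ ∩ Ω := by
      intro h
      refine hU0 ((ae_restrict_iff' (hG₀.inter hΩo).measurableSet).2 ?_)
      filter_upwards [hzero] with x hx hxG
      rcases hx hxG.2 with hx | ⟨i, hi, -⟩
      · exact hx.1
      · rw [← h] at hxG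
        exact absurd (subset_closure (mem_iUnion.2 ⟨i, hi⟩)) hxG.2
    obtain ⟨hZne, hZdisj⟩ := frontier_connectedComponentIn hconn.isPreconnected hHo
      inter_subset_left hHne (hB₀H hx₀)
    have hZo : IsOpen (connectedComponentIn (G₀ ∩ Ω ∩ (closure N)ᶜ) x₀) :=
      hHo.connectedComponentIn
    have hZH : connectedComponentIn (G₀ ∩ Ω ∩ (closure N)ᶜ) x₀ ⊆ G₀ ∩ Ω ∩ (closure N)ᶜ :=
      connectedComponentIn_subset _ _
    have hZc : IsConnected (connectedComponentIn (G₀ ∩ Ω ∩ (closure N)ᶜ) x₀) :=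
      isConnected_connectedComponentIn_iff.2 (hB₀H hx₀)
    have hB₀Z : B₀ ∩ Ω ⊆ connectedComponentIn (G₀ ∩ Ω ∩ (closure N)ᶜ) x₀ :=
      hB₀Ω.isPreconnected.subset_connectedComponentIn hx₀ hB₀H
    generalize connectedComponentIn (G₀ ∩ Ω ∩ (closure N)ᶜ) x₀ = Z at *
    have hZN : Disjoint Z N := Set.disjoint_left.2 fun x hx hxN => (hZH hx).2 (subset_closure hxN)
    obtain ⟨i, q, B, hqZ, hqB, hB, hBG, hBc, hBO, hBsub, hsign⟩ :=
      hcontact (A := Z) (K := G₀ ∩ Ω) hZo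
      (fun i => hZN.mono_right (subset_iUnion (fun i : ι => O i) i)) (hG₀.inter hΩo) hZne
      (fun x hx => hcover x
        (by
          by_contra h
          exact Set.disjoint_left.1 hZdisj ⟨hx.1, h⟩ hx.2)
        (Set.disjoint_left.1 (hZN.closure_left hNo) (frontier_subset_closure hx.2)))
    have hV : (Z ∪ B ∪ B₀) ∩ Ω = Z ∪ B := by
      rw [union_inter_distrib_right, inter_eq_left.2 (union_subset (fun x hx => (hZH hx).1.2)
        fun x hx => (hBG hx).2)]
      exact union_eq_left.2 (hB₀Z.trans subset_union_left)
    refine ⟨(Z ∪ B ∪ B₀) ∩ closure Ω, ⟨_, (hZo.union hB).union hB₀, rfl⟩,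
      ⟨?_, p', ⟨Or.inr hp'B₀, frontier_subset_closure hp'Ω⟩, hp'Ω⟩, ?_, ?_⟩
    · rw [hUΩ, hV]
      obtain ⟨z, hzB, hzZ⟩ := mem_closure_iff.1 (frontier_subset_closure hqZ) B hB hqB
      exact hZc.union ⟨z, hzZ, hzB⟩ hBc
    · refine inter_subset_inter_left _ (union_subset (union_subset ?_ ?_) ?_)
      · exact fun x hx => (hZH hx).1.1
      · exact fun x hx => (hBG hx).1
      · exact fun x hx => (hB₀sub hx).1
    · rw [hUΩ, hV]
      refine not_ae_zero_and_definite (hZo.union hB).measurableSet (hB.inter (hO i).1)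
        hBO.nonempty (inter_subset_left.trans subset_union_right) ?_ hsign
      filter_upwards [hzero] with x hx hxV
      have hxΩ : x ∈ Ω := by rw [← hV] at hxV; exact hxV.2
      rcases hx hxΩ with ⟨h0, hxN⟩ | ⟨j, hj, hσx⟩
      · exact Or.inl ⟨h0, fun h => hxN (mem_iUnion.2 ⟨i, h.2⟩)⟩
      · have hxN : x ∈ N := mem_iUnion.2 ⟨j, hj⟩
        have hxZ : x ∉ closure Z := fun h => Set.disjoint_left.1 (hZN.closure_left hNo) h hxN
        have hxB : x ∈ B := hxV.resolve_left fun h => hxZ (subset_closure h)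
        have hxO : x ∈ O i := (hBsub hxB).resolve_left fun h =>
          hxZ (h.elim (fun h => subset_closure h) fun h => frontier_subset_closure h)
        have hji : j = i := by
          by_contra hne
          exact Set.disjoint_left.1 (hdisj (Subtype.coe_injective.ne hne)) hj hxO
        exact Or.inr ⟨⟨hxB, hxO⟩, hji ▸ hσx⟩
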